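/- **Model.** A group of $n_s$ senders and $n_r$ receivers, all labelled, moves on the real line. A trajectory is a map $X:[0,\infty)\to\mathbb R$ with $X(0)=0$ and $|X(t')-X(t)|\le t'-t$ for all $t'\ge t\ge 0$. A target lies at an unknown point $x$. An agent *finds* the target when it is at $x$. An agent that knows of the target can notify every agent that is co-located with it; moreover a sender that knows of the target can instantaneously notify all receivers, at any distance; there is no other communication. An *evacuation algorithm* $\mathcal A$ assigns to every agent a search trajectory and, for every target location $x$, determines trajectories of all agents (their motion when the target is at $x$), such that every agent follows its search trajectory until it finds the target or is notified of it; from then on it may move arbitrarily (at speed at most $1$). The evacuation time $E(\mathcal A,x)\in[0,\infty]$ is the time at which the last agent reaches the target at $x$, that is, the maximum over the agents of the first time at which the agent is at $x$ ($\infty$ if some agent never is). The *competitive ratio* is $$\mathrm{CR}(\mathcal A)=\sup_{|x|>1}\frac{E(\mathcal A,x)}{|x|}\in[0,\infty].$$ **Theorem.** Let $\mathcal A$ be an evacuation algorithm for one sender and $n_r\ge 1$ receivers. Then $$\mathrm{CR}(\mathcal A)\ \ge\ \begin{cases}3+2\sqrt2, & n_r=1,\\ 2+\sqrt5, & n_r>1.\end{cases}$$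 -/

import Mathlib

open scoped NNReal ENNReal

namespace LineEvacuation

/-- An agent trajectory: time `t ≥ 0` is mapped to a position on the line; the agent starts at the
origin and has maximum speed `1` (so the map is in particular continuous). -/
structure IsTrajectory (X : ℝ≥0 → ℝ) : Prop where
  start : X 0 = 0
  speed : ∀ t t' : ℝ≥0, t ≤ t' → |X t' - X t| ≤ (t' : ℝ) - (t : ℝ)

/-- The agents: `ns` labelled senders (`Sum.inl`) and `nr` labelled receivers (`Sum.inr`). -/
abbrev Agent (ns nr : ℕ) : Type := Fin ns ⊕ Fin nr

/-- `Wireless j i`: messages of agent `j` reach agent `i` at any distance. This is so exactly when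
`j` is a sender and `i` is a receiver. -/
def Wireless {ns nr : ℕ} (j i : Agent ns nr) : Prop :=
  j.isLeft = true ∧ i.isRight = true

/-- `Informed X x i t`: if the agents move along `X` and the target is at `x`, then by time `t`
agent `i` has found the target or can have been notified of it. This is the least relation
that is closed under finding the target, remembering, communication between co-located agents
(of any kind), and instantaneous wireless transmission from senders to receivers. -/
inductive Informed {ns nr : ℕ} (X : Agent ns nr → ℝ≥0 → ℝ) (x : ℝ) : Agent ns nr → ℝ≥0 → Prop
  | find {i : Agent ns nr} {t : ℝ≥0} (h : X i t = x) : Informed X x i t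
  | remember {i : Agent ns nr} {s t : ℝ≥0} (hst : s ≤ t) (h : Informed X x i s) :
      Informed X x i t
  | meet {i j : Agent ns nr} {t : ℝ≥0} (hij : X i t = X j t) (h : Informed X x j t) :
      Informed X x i t
  | hear {i j : Agent ns nr} {t : ℝ≥0} (hij : Wireless j i) (h : Informed X x j t) :
      Informed X x i t

/-- An evacuation algorithm for `ns` senders and `nr` receivers. -/
structure EvacuationAlgorithm (ns nr : ℕ) where
  /-- The assigned search trajectories. -/
  search : Agent ns nr → ℝ≥0 → ℝ
  /-- The actual motion `run x` of the agents when the target is at `x`. -/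
  run : ℝ → Agent ns nr → ℝ≥0 → ℝ
  search_isTrajectory : ∀ i, IsTrajectory (search i)
  run_isTrajectory : ∀ x i, IsTrajectory (run x i)
  /-- Every agent follows its assigned trajectory until it finds the target or is notified of it;
  from then on it may move in any way, depending on the location of the target. -/
  run_eq_search : ∀ x i t, ¬ Informed (run x) x i t → run x i t = search i t

namespace EvacuationAlgorithm

variable {ns nr : ℕ}

/-- The first time at which agent `i` reaches the target at `x` (`∞` if it never does). -/
noncomputable def reachTime (A : EvacuationAlgorithm ns nr) (x : ℝ) (i : Agent ns nr) : ℝ≥0∞ :=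
  ⨅ (t : ℝ≥0) (_ : A.run x i t = x), (t : ℝ≥0∞)

/-- The evacuation time `E(A, x)`: the time at which the last agent reaches the target at `x`. -/
noncomputable def evacuationTime (A : EvacuationAlgorithm ns nr) (x : ℝ) : ℝ≥0∞ :=
  ⨆ i : Agent ns nr, A.reachTime x i

/-- The competitive ratio `sup_{|x| > 1} E(A, x) / |x|`, a value in `[0, ∞]`. -/
noncomputable def competitiveRatio (A : EvacuationAlgorithm ns nr) : ℝ≥0∞ :=
  ⨆ (x : ℝ) (_ : 1 < |x|), A.evacuationTime x / ENNReal.ofReal |x|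

end EvacuationAlgorithm

end LineEvacuation

namespace LineEvacuation

/-! An algorithm of ratio below C is reduced to its search paths (`isSearchPlan`): until the sender
learns of a target, news spreads at speed at most 1, and an agent still ignorant must be able to
reach the target before time C|x|. Both bounds then come from delays that amplify themselves.

For any number of receivers, a ratio below 17/4, which exceeds 2 + √5, is impossible. By
`IsSearchPlan.pair` the sender stays ignorant of one of two opposite targets for a while, which
keeps all agents from straying far to the other side, so far points there are found late. A delay on
one side feeds the other (`delayedBeyond_of_below`), and once both exceed 5/4 of the distance the
excess doubles forever (`not_delayed_both`). Connectedness of (1, ∞) leaves plans that lean to one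
side at all times, which `false_of_forall_le` excludes.

With one receiver, let A = C - 1 and suppose that far points x are visited no earlier than (ν -
1)|x|. Then the sender is later still, and weighing -y against νy/A delays all far visits, raising ν
by at least `delayGain A`, which is positive as A < 2 + 2√2. But ν stays below A (`lt_of_slowFrom`),
so iteration gives a contradiction. -/

/-- Search paths `q` (in real time) of agents that are able to evacuate from every `x` with
`1 < |x|` before time `C * |x|`, where only the sender `s` can transmit wirelessly. In `notify`, `D`
is a lower bound for the time at which the target is found, and `t₁` is the time at which the sender
learns of it: the news travels at speed at most `1` until then. -/
structure IsSearchPlan {ι : Type*} (C : ℝ) (q : ι → ℝ → ℝ) (s : ι) : Prop where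
  start : ∀ i, q i 0 = 0
  lipschitz : ∀ i t t', |q i t - q i t'| ≤ |t - t'|
  notify : ∀ x D, 1 < |x| → (∀ i t, 0 ≤ t → q i t = x → D ≤ t) →
    ∃ t₁, 0 ≤ t₁ ∧ D + |x - q s t₁| ≤ t₁ ∧ t₁ + |x - q s t₁| < C * |x| ∧
      ∀ i T, 0 ≤ T → T ≤ t₁ → D + |x - q i T| ≤ T ∨ T + |x - q i T| < C * |x|

theorem IsTrajectory.abs_sub_le_abs_sub {X : ℝ≥0 → ℝ} (hX : IsTrajectory X) (t t' : ℝ≥0) :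
    |X t - X t'| ≤ |(t : ℝ) - t'| := by
  rcases le_total t t' with h | h
  · rw [abs_sub_comm, abs_sub_comm (t : ℝ)]
    exact (hX.speed _ _ h).trans (le_abs_self _)
  · exact (hX.speed _ _ h).trans (le_abs_self _)

theorem IsTrajectory.continuous {X : ℝ≥0 → ℝ} (hX : IsTrajectory X) : Continuous X := by
  refine (LipschitzWith.of_dist_le_mul (K := 1) fun t t' => ?_).continuous
  simpa [Real.dist_eq, NNReal.dist_eq] using hX.abs_sub_le_abs_sub t t'

/-- Moving from time `s` to a later time `t` changes the distance to `x` by at most `t - s`. -/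
theorem IsTrajectory.dist_le {X : ℝ≥0 → ℝ} (hX : IsTrajectory X) (x : ℝ) {s t : ℝ≥0}
    (hst : s ≤ t) : |x - X t| ≤ |x - X s| + (t - s) ∧ |x - X s| ≤ |x - X t| + (t - s) := by
  have h := hX.speed s t hst
  constructor
  · have := abs_sub_le x (X s) (X t)
    rw [abs_sub_comm (X s)] at this
    linarith
  · have := abs_sub_le x (X t) (X s)
    linarith

/-! ### Spread of information in a run -/

section Information

variable {ns nr : ℕ} {X : Agent ns nr → ℝ≥0 → ℝ} {x : ℝ} {i : Agent ns nr} {t : ℝ≥0}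

theorem Informed.exists_found (h : Informed X x i t) : ∃ s ≤ t, ∃ j, X j s = x := by
  induction h with
  | @find i t h => exact ⟨t, le_rfl, i, h⟩
  | remember hst _ ih =>
    obtain ⟨s, hs, j, hj⟩ := ih
    exact ⟨s, hs.trans hst, j, hj⟩
  | meet _ _ ih => exact ih
  | hear _ _ ih => exact ih

end Information

namespace EvacuationAlgorithm

variable {ns nr : ℕ} (A : EvacuationAlgorithm ns nr) {x D : ℝ}

/-- By continuity, run and search path still agree at the first informed time itself. -/
theorem run_eq_search_of_forall_lt {i : Agent ns nr} {t : ℝ≥0}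
    (h : ∀ s < t, ¬ Informed (A.run x) x i s) : A.run x i t = A.search i t := by
  rcases eq_or_ne t 0 with rfl | ht
  · rw [(A.run_isTrajectory x i).start, (A.search_isTrajectory i).start]
  by_contra hne
  set d := |A.run x i t - A.search i t| with hd
  have hd0 : 0 < d := abs_pos.2 (sub_ne_zero.2 hne)
  set e : ℝ≥0 := (d / 4).toNNReal with he
  have he' : (e : ℝ) = d / 4 := Real.coe_toNNReal _ (by positivity)
  have hlt : t - e < t := tsub_lt_self (pos_iff_ne_zero.2 ht) (Real.toNNReal_pos.2 (by positivity))
  have hs := A.run_eq_search x i _ (h _ hlt)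
  have h1 := (A.run_isTrajectory x i).speed _ _ hlt.le
  have h2 := (A.search_isTrajectory i).speed _ _ hlt.le
  have h3 : (t : ℝ) - (t - e : ℝ≥0) ≤ d / 4 := by
    have : (t : ℝ) ≤ (t - e : ℝ≥0) + e := by exact_mod_cast le_tsub_add
    linarith
  rw [abs_sub_comm] at h2
  have h4 := abs_sub_le (A.run x i t) (A.run x i (t - e)) (A.search i t)
  rw [hs] at h4 h1
  linarith

theorem le_of_run_eq (hD : ∀ i t, A.search i t = x → D ≤ (t : ℝ≥0)) {j : Agent ns nr} {t : ℝ≥0}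
    (h : A.run x j t = x) : D ≤ t := by
  set J : Set ℝ≥0 := ⋃ k, A.run x k ⁻¹' {x} with hJ
  have hJc : IsClosed J :=
    isClosed_iUnion_of_finite fun k =>
      isClosed_singleton.preimage (A.run_isTrajectory x k).continuous
  have htJ : t ∈ J := Set.mem_iUnion.2 ⟨j, h⟩
  have hmem : sInf J ∈ J := hJc.csInf_mem ⟨t, htJ⟩ (OrderBot.bddBelow _)
  obtain ⟨k, hk⟩ := Set.mem_iUnion.1 hmem
  have hk' : A.search k (sInf J) = x := by
    rw [← A.run_eq_search_of_forall_lt (x := x)]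
    · exact hk
    · intro s hs hinf
      obtain ⟨s', hs', l, hl⟩ := hinf.exists_found
      exact absurd (csInf_le (OrderBot.bddBelow _) (Set.mem_iUnion.2 ⟨l, hl⟩))
        (not_le.2 (hs'.trans_lt hs))
  exact (hD k _ hk').trans (NNReal.coe_le_coe.2 (csInf_le (OrderBot.bddBelow _) htJ))

/-- The first time at which an agent is informed, if its news satisfies the speed bound. -/
theorem exists_first_informed {i : Agent ns nr} {t₀ : ℝ≥0} (h₀ : Informed (A.run x) x i t₀)
    (h : ∀ t ≤ t₀, Informed (A.run x) x i t → D + |x - A.run x i t| ≤ t) :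
    ∃ τ ≤ t₀, (∀ s < τ, ¬ Informed (A.run x) x i s) ∧ D + |x - A.search i τ| ≤ τ := by
  set J : Set ℝ≥0 := {t | Informed (A.run x) x i t} with hJ
  have hbelow : ∀ s < sInf J, ¬ Informed (A.run x) x i s := fun s hs hinf =>
    absurd (csInf_le (OrderBot.bddBelow _) (show s ∈ J from hinf)) (not_le.2 hs)
  have hle : sInf J ≤ t₀ := csInf_le (OrderBot.bddBelow _) h₀
  refine ⟨sInf J, hle, hbelow, ?_⟩
  rw [← A.run_eq_search_of_forall_lt hbelow]
  -- The infimum is not shown to be an informed time, so the bound is passed to the limit.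
  refine le_of_forall_pos_le_add fun ε hε => ?_
  have hlt : sInf J < sInf J + (ε / 2).toNNReal :=
    lt_add_of_pos_right _ (Real.toNNReal_pos.2 (by positivity))
  obtain ⟨t, htJ, ht⟩ := exists_lt_of_csInf_lt ⟨t₀, h₀⟩ hlt
  obtain ⟨t', ht'J, ht't₀, ht'⟩ :
      ∃ t', Informed (A.run x) x i t' ∧ t' ≤ t₀ ∧ t' < sInf J + (ε / 2).toNNReal := by
    rcases le_total t t₀ with h' | h'
    · exact ⟨t, htJ, h', ht⟩
    · exact ⟨t₀, h₀, le_rfl, h'.trans_lt ht⟩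
  have h1 := h t' ht't₀ ht'J
  have h2 := ((A.run_isTrajectory x i).dist_le x
    (csInf_le (OrderBot.bddBelow _) (show t' ∈ J from ht'J))).2
  have h3 : (t' : ℝ) < sInf J + ε / 2 := by
    have := NNReal.coe_lt_coe.2 ht'
    rwa [NNReal.coe_add, Real.coe_toNNReal _ (by positivity)] at this
  linarith

end EvacuationAlgorithm

namespace EvacuationAlgorithm

variable {nr : ℕ} (A : EvacuationAlgorithm 1 nr) {x D C : ℝ}

theorem eq_sender_of_wireless {i j : Agent 1 nr} (h : Wireless j i) : j = Sum.inl 0 := by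
  rcases j with j | j
  · rw [Subsingleton.elim j 0]
  · simp [Wireless] at h

/-- Only the sender transmits wirelessly, so news that ever went by wireless had already reached the
sender at speed at most 1; on any other route agents carry it. -/
theorem dist_le_of_informed_sender (hD : ∀ i t, A.search i t = x → D ≤ (t : ℝ≥0)) {t : ℝ≥0}
    (h : Informed (A.run x) x (Sum.inl 0) t) : D + |x - A.run x (Sum.inl 0) t| ≤ t := by
  have key : ∀ i t, Informed (A.run x) x i t → D + |x - A.run x i t| ≤ t ∨
      ∃ s ≤ t, D + |x - A.run x (Sum.inl 0) s| ≤ s := by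
    intro i t h
    induction h with
    | find h =>
      left
      rw [h, sub_self, abs_zero, add_zero]
      exact A.le_of_run_eq hD h
    | @remember i s t hst _ ih =>
      rcases ih with ih | ⟨s', hs', ih⟩
      · left
        have := ((A.run_isTrajectory x i).dist_le x hst).1
        linarith
      · exact Or.inr ⟨s', hs'.trans hst, ih⟩
    | meet hij _ ih => rwa [hij]
    | @hear i j t hij _ ih =>
      right
      rcases ih with ih | ih
      · rw [eq_sender_of_wireless hij] at ih
        exact ⟨t, le_rfl, ih⟩
      · exact ih
  rcases key _ _ h with h | ⟨s, hs, h⟩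
  · exact h
  · have := ((A.run_isTrajectory x (Sum.inl 0)).dist_le x hs).1
    linarith

theorem dist_le_of_not_informed_sender (hD : ∀ i t, A.search i t = x → D ≤ (t : ℝ≥0))
    {i : Agent 1 nr} {t : ℝ≥0} (h : Informed (A.run x) x i t)
    (hs : ¬ Informed (A.run x) x (Sum.inl 0) t) : D + |x - A.run x i t| ≤ t := by
  induction h with
  | find h =>
    rw [h, sub_self, abs_zero, add_zero]
    exact A.le_of_run_eq hD h
  | @remember i s t hst _ ih =>
    have := ((A.run_isTrajectory x i).dist_le x hst).1
    have := ih fun h => hs (h.remember hst)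
    linarith
  | meet hij _ ih =>
    rw [hij]
    exact ih hs
  | hear hij h _ =>
    rw [eq_sender_of_wireless hij] at h
    exact absurd h hs

theorem exists_run_eq (hC : A.competitiveRatio < ENNReal.ofReal C) (hx : 1 < |x|)
    (i : Agent 1 nr) : ∃ t : ℝ≥0, A.run x i t = x ∧ t < C * |x| := by
  have hx0 : 0 < |x| := by linarith
  have h1 : A.evacuationTime x / ENNReal.ofReal |x| < ENNReal.ofReal C :=
    (le_iSup₂_of_le (f := fun (x : ℝ) (_ : 1 < |x|) => A.evacuationTime x / ENNReal.ofReal |x|)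
      x hx le_rfl).trans_lt hC
  have h2 : A.evacuationTime x < ENNReal.ofReal C * ENNReal.ofReal |x| :=
    (ENNReal.div_lt_iff (Or.inl (by simpa using hx0)) (Or.inl ENNReal.ofReal_ne_top)).1 h1
  have h3 : A.reachTime x i < ENNReal.ofReal C * ENNReal.ofReal |x| :=
    (le_iSup (A.reachTime x) i).trans_lt h2
  have hC0 : 0 < C := ENNReal.ofReal_pos.1 (bot_le.trans_lt hC)
  rw [← ENNReal.ofReal_mul hC0.le] at h3
  obtain ⟨t, ht⟩ := iInf_lt_iff.1 h3
  obtain ⟨ht', ht⟩ := iInf_lt_iff.1 ht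
  refine ⟨t, ht', ?_⟩
  rw [← ENNReal.ofReal_coe_nnreal] at ht
  exact (ENNReal.ofReal_lt_ofReal_iff (by positivity)).1 ht

/-- Take `t₁` to be the infimum of the sender's informed times. Before it nothing is transmitted
wirelessly, so informed agents lie in the speed-1 cone of the find; the others are on their search
paths and must still arrive in time. -/
theorem isSearchPlan (hC : A.competitiveRatio < ENNReal.ofReal C) :
    IsSearchPlan C (fun i t => A.search i t.toNNReal) (Sum.inl 0) where
  start i := by simpa using (A.search_isTrajectory i).start
  lipschitz i t t' := by
    refine ((A.search_isTrajectory i).abs_sub_le_abs_sub _ _).trans ?_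
    rw [Real.coe_toNNReal', Real.coe_toNNReal']
    exact abs_max_sub_max_le_abs t t' 0
  notify x D hx hD := by
    have hD' : ∀ i t, A.search i t = x → D ≤ (t : ℝ≥0) := fun i t h =>
      hD i t t.2 (by simpa using h)
    have hreach := fun i => A.exists_run_eq hC hx i
    obtain ⟨t₀, ht₀, -⟩ := hreach (Sum.inl 0)
    obtain ⟨τ, -, hτ, hτD⟩ := A.exists_first_informed (.find ht₀)
      fun t _ h => A.dist_le_of_informed_sender hD' h
    have late : ∀ i (T : ℝ≥0), (∀ s < T, ¬ Informed (A.run x) x i s) →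
        T + |x - A.search i T| < C * |x| := by
      intro i T hT
      obtain ⟨t, ht, htC⟩ := hreach i
      have hTt : T ≤ t := not_lt.1 fun h => hT t h (.find ht)
      rw [← A.run_eq_search_of_forall_lt hT]
      have := ((A.run_isTrajectory x i).dist_le x hTt).2
      rw [ht, sub_self, abs_zero] at this
      linarith
    refine ⟨τ, τ.2, by simpa using hτD, by simpa using late _ τ hτ, fun i T hT0 hT => ?_⟩
    lift T to ℝ≥0 using hT0
    rw [NNReal.coe_le_coe] at hT
    rw [Real.toNNReal_coe]
    by_cases hi : ∃ t < T, Informed (A.run x) x i t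
    · obtain ⟨t, htT, ht⟩ := hi
      obtain ⟨τ', hτ't, -, hτ'⟩ := A.exists_first_informed ht fun t' ht' h =>
        A.dist_le_of_not_informed_sender hD' h (hτ t' ((ht'.trans_lt htT).trans_le hT))
      have := ((A.search_isTrajectory i).dist_le x (hτ't.trans htT.le)).1
      left
      linarith
    · push Not at hi
      exact Or.inr (late i T hi)

end EvacuationAlgorithm

/-! ### Cone inequalities for search plans -/

namespace IsSearchPlan

variable {ι : Type*} {C : ℝ} {q : ι → ℝ → ℝ} {s : ι}

theorem neg (h : IsSearchPlan C q s) : IsSearchPlan C (fun i t => -q i t) s where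
  start i := by simp [h.start i]
  lipschitz i t t' := by
    rw [← abs_neg]
    convert h.lipschitz i t t' using 2
    ring
  notify x D hx hD := by
    obtain ⟨t₁, h0, h1, h2, h3⟩ := h.notify (-x) D (by rwa [abs_neg])
      fun i t ht hi => hD i t ht (by simp [hi])
    have e : ∀ y, |x - -y| = |-x - y| := fun y => by rw [← abs_neg]; congr 1; ring
    refine ⟨t₁, h0, ?_⟩
    simp only [e]
    rw [abs_neg] at h2 h3
    exact ⟨h1, h2, h3⟩

theorem mono {C' : ℝ} (h : IsSearchPlan C q s) (hC : C ≤ C') : IsSearchPlan C' q s where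
  start := h.start
  lipschitz := h.lipschitz
  notify x D hx hD := by
    have hCC : C * |x| ≤ C' * |x| := mul_le_mul_of_nonneg_right hC (abs_nonneg x)
    obtain ⟨t₁, h0, h1, h2, h3⟩ := h.notify x D hx hD
    exact ⟨t₁, h0, h1, h2.trans_le hCC, fun i T hT hT' =>
      (h3 i T hT hT').imp_right fun h => h.trans_le hCC⟩

theorem continuous (h : IsSearchPlan C q s) (i : ι) : Continuous (q i) :=
  (LipschitzWith.of_dist_le_mul (K := 1) fun t t' => by
    simpa [Real.dist_eq] using h.lipschitz i t t').continuous

theorem sub_le (h : IsSearchPlan C q s) (i : ι) {t t' : ℝ} (ht : t ≤ t') :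
    q i t' - q i t ≤ t' - t ∧ q i t - q i t' ≤ t' - t := by
  have := h.lipschitz i t' t
  rw [abs_of_nonneg (sub_nonneg.2 ht)] at this
  constructor <;> linarith [abs_le.1 this]

theorem le_time (h : IsSearchPlan C q s) (i : ι) {t : ℝ} (ht : 0 ≤ t) : q i t ≤ t ∧ -q i t ≤ t := by
  have := h.sub_le i ht
  rw [h.start] at this
  constructor <;> linarith

/-- Before the target is found nobody knows of it, and everybody must still be able to reach it. -/
theorem lt_of_not_found (h : IsSearchPlan C q s) {x D : ℝ} (hx : 1 < |x|) (hD0 : 0 ≤ D)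
    (hD : ∀ i t, 0 ≤ t → q i t = x → D ≤ t) (i : ι) : D + |x - q i D| < C * |x| := by
  obtain ⟨t₁, h0, h1, h2, h3⟩ := h.notify x D hx hD
  have := abs_nonneg (x - q s t₁)
  rcases h3 i D hD0 (by linarith) with h | h
  · linarith
  · exact h

/-- Of two targets on different sides, one is not yet known to the sender at time `T`. -/
theorem pair (h : IsSearchPlan C q s) {x y Dx Dy T : ℝ} (hx : 1 < x) (hy : 1 < y)
    (hDx : ∀ i t, 0 ≤ t → q i t = x → Dx ≤ t) (hDy : ∀ i t, 0 ≤ t → q i t = -y → Dy ≤ t)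
    (hT0 : 0 ≤ T) (hT : 2 * T ≤ Dx + x + (Dy + y)) :
    (T < C * x ∧ ∀ i, Dx + x - q i T ≤ T ∨ T + x - q i T < C * x) ∨
    (T < C * y ∧ ∀ i, Dy + y + q i T ≤ T ∨ T + y + q i T < C * y) := by
  have ax : |x| = x := abs_of_pos (by linarith)
  have ay : |-y| = y := by rw [abs_neg]; exact abs_of_pos (by linarith)
  obtain ⟨t₁, -, h1, h2, h3⟩ := h.notify x Dx (by rwa [ax]) hDx
  obtain ⟨t₂, -, k1, k2, k3⟩ := h.notify (-y) Dy (by rwa [ay]) hDy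
  rw [ax] at h2 h3
  rw [ay] at k2 k3
  -- Otherwise the two cone inequalities add up to `Dx + x + Dy + y ≤ t₁ + t₂ + |t₁ - t₂| < 2 * T`.
  have hmax : T ≤ t₁ ∨ T ≤ t₂ := by
    by_contra! hlt
    have a1 := le_abs_self (x - q s t₁)
    have a2 := neg_le_abs (-y - q s t₂)
    rcases le_total t₁ t₂ with ht | ht
    · linarith [(h.sub_le s ht).2]
    · linarith [(h.sub_le s ht).1]
  rcases hmax with hT₁ | hT₁
  · refine Or.inl ⟨by linarith [abs_nonneg (x - q s t₁)], fun i => ?_⟩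
    have := le_abs_self (x - q i T)
    exact (h3 i T hT0 hT₁).imp (fun _ => by linarith) fun _ => by linarith
  · refine Or.inr ⟨by linarith [abs_nonneg (-y - q s t₂)], fun i => ?_⟩
    have := neg_le_abs (-y - q i T)
    exact (k3 i T hT0 hT₁).imp (fun _ => by linarith) fun _ => by linarith

end IsSearchPlan

/-- Positions `z ≥ b` are visited at time `z + r` at the earliest. -/
def DelayedBeyond {ι : Type*} (q : ι → ℝ → ℝ) (b r : ℝ) : Prop :=
  ∀ i t, 0 ≤ t → b ≤ q i t → q i t + r ≤ t

/-- The same for the negative half-line. -/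
abbrev DelayedBelow {ι : Type*} (q : ι → ℝ → ℝ) (a p : ℝ) : Prop :=
  DelayedBeyond (fun i t => -q i t) a p

theorem DelayedBeyond.mono {ι : Type*} {q : ι → ℝ → ℝ} {b r b' r' : ℝ} (h : DelayedBeyond q b r)
    (hb : b ≤ b') (hr : r' ≤ r) : DelayedBeyond q b' r' := fun i t ht hq =>
  (add_le_add_right hr _).trans (h i t ht (hb.trans hq))

theorem DelayedBeyond.le_of_eq {ι : Type*} {q : ι → ℝ → ℝ} {m r : ℝ} (h : DelayedBeyond q m r)
    (i : ι) (t : ℝ) (ht : 0 ≤ t) (hq : q i t = m) : m + r ≤ t := by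
  have := h i t ht hq.ge
  rwa [hq] at this

theorem DelayedBelow.le_of_eq {ι : Type*} {q : ι → ℝ → ℝ} {m p : ℝ} (h : DelayedBelow q m p)
    (i : ι) (t : ℝ) (ht : 0 ≤ t) (hq : q i t = -m) : m + p ≤ t :=
  DelayedBeyond.le_of_eq h i t ht (by simp [hq])

namespace IsSearchPlan

variable {ι : Type*} {C : ℝ} {q : ι → ℝ → ℝ} {s : ι}

theorem delayedBeyond_zero (h : IsSearchPlan C q s) (b : ℝ) : DelayedBeyond q b 0 :=
  fun i t ht _ => by linarith [(h.le_time i ht).1]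

/-- If all agents are at most at `u` at time `T`, then points further out are found late. -/
theorem delayedBeyond_of_le (h : IsSearchPlan C q s) {b r b' T u : ℝ} (hb : DelayedBeyond q b r)
    (hT : ∀ i, q i T ≤ u) (hbb : b ≤ b') (hb' : T + u - r < 2 * b') :
    DelayedBeyond q b' (T - u) := by
  intro i t ht hq
  have hu := hT i
  rcases le_total T t with htT | htT
  · linarith [(h.sub_le i htT).1]
  -- An agent at z ≥ b' before T needs time z + r to get there and z - u to return to u: too long by
  -- `hb'`.
  · linarith [(h.sub_le i htT).2, hb i t ht (hbb.trans hq)]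

end IsSearchPlan

/-! ### Any number of receivers: no ratio below 17/4 -/

section SeventeenQuarters

variable {ι : Type*} {q : ι → ℝ → ℝ} {s : ι}

/-- If points on the left are found late, then all agents must have stayed near, so that
points on the right are found late as well. -/
theorem IsSearchPlan.delayedBeyond_of_below (h : IsSearchPlan (17 / 4) q s) {m b p r b' : ℝ}
    (hm : 1 < m) (hp0 : 0 ≤ p) (hp : DelayedBelow q m p) (hr : DelayedBeyond q b r) (hbb : b ≤ b')
    (hb' : 13 / 4 * m - r < 2 * b') : DelayedBeyond q b' (2 * p - 5 / 4 * m) := by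
  have am : |-m| = m := by rw [abs_neg]; exact abs_of_pos (by linarith)
  -- At time m + p everyone must still be able to reach -m, so nobody is to the right of 9/4 m - p.
  have key := h.lt_of_not_found (x := -m) (D := m + p) (by rwa [am]) (by linarith) hp.le_of_eq
  rw [am] at key
  have := h.delayedBeyond_of_le (T := m + p) (u := 13 / 4 * m - (m + p)) hr
    (fun i => by linarith [key i, neg_le_abs (-m - q i (m + p))]) hbb (by linarith)
  exact this.mono le_rfl (by linarith)

theorem IsSearchPlan.delayedBelow_of_beyond (h : IsSearchPlan (17 / 4) q s) {m a p r a' : ℝ}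
    (hm : 1 < m) (hr0 : 0 ≤ r) (hr : DelayedBeyond q m r) (hp : DelayedBelow q a p) (haa : a ≤ a')
    (ha' : 13 / 4 * m - p < 2 * a') : DelayedBelow q a' (2 * r - 5 / 4 * m) :=
  h.neg.delayedBeyond_of_below hm hr0 (by simpa [DelayedBeyond] using hr) hp haa ha'

/-- The map p ↦ 2p - 5/4 m between the two sides doubles the excess over its fixed point 5/4 m. -/
theorem IsSearchPlan.not_delayed_both (h : IsSearchPlan (17 / 4) q s) {m e : ℝ} (hm : 1 < m)
    (he : 0 < e) (hr : DelayedBeyond q m (5 / 4 * m + e)) (hp : DelayedBelow q m (5 / 4 * m + e)) :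
    False := by
  have key : ∀ n : ℕ, DelayedBeyond q m (5 / 4 * m + 2 ^ n * e) ∧
      DelayedBelow q m (5 / 4 * m + 2 ^ n * e) := by
    intro n
    induction n with
    | zero => simpa using ⟨hr, hp⟩
    | succ n ih =>
      have hpos : 0 < 2 ^ n * e := by positivity
      obtain ⟨ih1, ih2⟩ := ih
      rw [pow_succ]
      exact ⟨(h.delayedBeyond_of_below hm (by linarith) ih2 ih1 le_rfl (by linarith)).mono le_rfl
          (by linarith),
        (h.delayedBelow_of_beyond hm (by linarith) ih1 ih2 le_rfl (by linarith)).mono le_rfl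
          (by linarith)⟩
  obtain ⟨n, hn⟩ := pow_unbounded_of_one_lt (2 * m / e) (one_lt_two : (1 : ℝ) < 2)
  rw [div_lt_iff₀ he] at hn
  have am : |m| = m := abs_of_pos (by linarith)
  have := h.lt_of_not_found (x := m) (D := m + (5 / 4 * m + 2 ^ n * e)) (by rwa [am])
    (by linarith) (key n).1.le_of_eq s
  rw [am] at this
  linarith [abs_nonneg (m - q s (m + (5 / 4 * m + 2 ^ n * e)))]

/-- A delay on both sides forces a larger delay on one of them. -/
theorem IsSearchPlan.delayed_or (h : IsSearchPlan (17 / 4) q s) {m p r : ℝ} (hm : 1 < m)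
    (hp0 : 0 ≤ p) (hr0 : 0 ≤ r) (hpm : p ≤ 5 / 4 * m) (hrm : r ≤ 5 / 4 * m)
    (hr : DelayedBeyond q m r) (hp : DelayedBelow q m p) :
    (∀ b', m ≤ b' → 13 / 4 * m - r < 2 * b' → DelayedBeyond q b' (3 / 4 * m + p + r)) ∨
    (∀ a', m ≤ a' → 13 / 4 * m - p < 2 * a' → DelayedBelow q a' (3 / 4 * m + p + r)) := by
  -- The largest T that `pair` allows. Agents already in the news cone obey the same position bound,
  -- because `p` and `r` are at most `5 / 4 * m`.
  rcases h.pair hm hm (T := 2 * m + (p + r) / 2) hr.le_of_eq hp.le_of_eq (by linarith)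
    (by linarith) with ⟨-, hT⟩ | ⟨-, hT⟩
  · right
    intro a' ha ha'
    refine (h.neg.delayedBeyond_of_le (T := 2 * m + (p + r) / 2)
      (u := 13 / 4 * m - (2 * m + (p + r) / 2)) hp (fun i => ?_) ha (by linarith)).mono le_rfl
        (by linarith)
    rcases hT i with h | h <;> linarith
  · left
    intro b' hb hb'
    refine (h.delayedBeyond_of_le (T := 2 * m + (p + r) / 2)
      (u := 13 / 4 * m - (2 * m + (p + r) / 2)) hr (fun i => ?_) hb (by linarith)).mono le_rfl
        (by linarith)
    rcases hT i with h | h <;> linarith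

/-- `delayed_or` creates a delay of 5.205x on one side; reflected to the other side, it yields two
delays above 5/4 of a common distance. The positions are the required thresholds, rounded up. -/
theorem IsSearchPlan.false_of_delayed (h : IsSearchPlan (17 / 4) q s) {x : ℝ} (hx : 1 < x)
    (hr : DelayedBeyond q (2.3 * x) (2.73 * x)) (hp : DelayedBelow q (1.64 * x) (0.75 * x)) :
    False := by
  rcases h.delayed_or (m := 2.3 * x) (by linarith) (by linarith) (by linarith) (by linarith)
    (by linarith) hr (hp.mono (by linarith) le_rfl) with h' | h'
  · have hr' := h' (2.38 * x) (by linarith) (by linarith)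
    have hp' := h.delayedBelow_of_beyond (by linarith) (by linarith) hr' hp
      (a' := 3.5 * x) (by linarith) (by linarith)
    exact h.not_delayed_both (m := 3.5 * x) (e := 0.5 * x) (by linarith) (by linarith)
      (hr'.mono (by linarith) (by linarith)) (hp'.mono (by linarith) (by linarith))
  · have hp' := h' (3.37 * x) (by linarith) (by linarith)
    have hr' := h.delayedBeyond_of_below (by linarith) (by linarith) hp' hr
      (b' := 4.12 * x) (by linarith) (by linarith)
    exact h.not_delayed_both (m := 4.12 * x) (e := 0.05 * x) (by linarith) (by linarith)
      (hr'.mono (by linarith) (by linarith)) (hp'.mono (by linarith) (by linarith))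

/-- At no time `2 * x` can all agents be close to the origin. -/
theorem IsSearchPlan.false_of_confined (h : IsSearchPlan (17 / 4) q s) {x : ℝ} (hx : 1 < x)
    (hu : ∀ i, q i (2 * x) ≤ 5 / 4 * x) (hl : ∀ i, -q i (2 * x) ≤ 5 / 4 * x) : False := by
  have hr : DelayedBeyond q (1.64 * x) (0.75 * x) :=
    (h.delayedBeyond_of_le (h.delayedBeyond_zero _) hu le_rfl (by linarith)).mono le_rfl
      (by linarith)
  have hp : DelayedBelow q (1.64 * x) (0.75 * x) :=
    (h.neg.delayedBeyond_of_le (h.neg.delayedBeyond_zero _) hl le_rfl (by linarith)).mono le_rfl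
      (by linarith)
  rcases h.delayed_or (by linarith) (by linarith) (by linarith) (by linarith)
    (by linarith) hr hp with h' | h'
  · exact h.false_of_delayed hx
      ((h' (2.3 * x) (by linarith) (by linarith)).mono le_rfl (by linarith)) hp
  · exact h.neg.false_of_delayed hx
      ((h' (2.3 * x) (by linarith) (by linarith)).mono le_rfl (by linarith))
      (by simpa [DelayedBeyond] using hr)

/-- Leaning left delays x to time 8/5 x. Pairing it with -3x/4 either confines the agents or
improves the bound to x/2, so 5 is not reached before time 20. Pairing 5 with -2 at time 10 > 17/4 *
2 then forces confinement. -/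
theorem IsSearchPlan.false_of_forall_le (h : IsSearchPlan (17 / 4) q s)
    (hu : ∀ x, 1 < x → ∀ i, q i (2 * x) ≤ 5 / 4 * x) : False := by
  have hu2 : ∀ x, 2 < x → ∀ i, q i (2 * x) ≤ 1 / 2 * x := by
    intro x hx
    have hx' : ∀ i t, 0 ≤ t → q i t = x → 8 / 5 * x ≤ t := fun i t ht hi => by
      have hxt := (h.le_time i ht).1
      have := hu (t / 2) (by linarith) i
      rw [mul_div_cancel₀ t two_ne_zero] at this
      linarith
    rcases h.pair (y := 3 / 4 * x) (Dy := 3 / 4 * x) (T := 2 * x) (by linarith) (by linarith)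
      hx' (fun i t ht hi => by linarith [(h.le_time i ht).2]) (by linarith)
      (by linarith) with ⟨-, hT⟩ | ⟨-, hT⟩
    · refine (h.false_of_confined (x := x) (by linarith) (hu x (by linarith)) fun i => ?_).elim
      rcases hT i with h | h <;> linarith
    · intro i
      rcases hT i with h | h <;> linarith
  have h5 : ∀ i t, 0 ≤ t → q i t = 5 → 20 ≤ t := fun i t ht hi => by
    have hxt := (h.le_time i ht).1
    have := hu2 (t / 2) (by linarith) i
    rw [mul_div_cancel₀ t two_ne_zero] at this
    linarith
  rcases h.pair (y := 2) (Dy := 2) (T := 2 * 5) (by norm_num) (by norm_num)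
    h5 (fun i t ht hi => by linarith [(h.le_time i ht).2]) (by norm_num)
    (by norm_num) with ⟨-, hT⟩ | ⟨hT, -⟩
  · refine h.false_of_confined (x := 5) (by norm_num) (hu 5 (by norm_num)) fun i => ?_
    have hTi := hT i
    generalize q i (2 * 5) = z at hTi ⊢
    rcases hTi with h | h <;> linarith
  · norm_num at hT

theorem not_isSearchPlan_seventeen_quarters (h : IsSearchPlan (17 / 4) q s) : False := by
  set B : Set ℝ := {x | ∀ i, q i (2 * x) ≤ 5 / 4 * x} with hB
  set B' : Set ℝ := {x | ∀ i, -q i (2 * x) ≤ 5 / 4 * x} with hB'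
  have hBc : IsClosed B := by
    simp only [hB, Set.ofPred_forall]
    exact isClosed_iInter fun i => isClosed_le ((h.continuous i).comp (by fun_prop)) (by fun_prop)
  have hBc' : IsClosed B' := by
    simp only [hB', Set.ofPred_forall]
    exact isClosed_iInter fun i =>
      isClosed_le ((h.continuous i).comp (by fun_prop)).neg (by fun_prop)
  have hcover : Set.Ioi (1 : ℝ) ⊆ B ∪ B' := by
    intro x hx
    have hx : 1 < x := hx
    rcases h.pair hx hx (Dx := x) (Dy := x) (T := 2 * x)
      (fun i t ht hi => hi ▸ (h.le_time i ht).1)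
      (fun i t ht hi => by linarith [(h.le_time i ht).2]) (by linarith)
      (by linarith) with ⟨-, hT⟩ | ⟨-, hT⟩
    · right
      intro i
      rcases hT i with h | h <;> linarith
    · left
      intro i
      rcases hT i with h | h <;> linarith
  have hdisj : ∀ x, 1 < x → x ∈ B → x ∉ B' := fun x hx h1 h2 => h.false_of_confined hx h1 h2
  by_cases hne : (Set.Ioi (1 : ℝ) ∩ B).Nonempty
  · by_cases hne' : (Set.Ioi (1 : ℝ) ∩ B').Nonempty
    · obtain ⟨x, hx, h1, h2⟩ :=
        isPreconnected_closed_iff.1 isPreconnected_Ioi B B' hBc hBc' hcover hne hne'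
      exact hdisj x hx h1 h2
    · exact h.false_of_forall_le fun x hx =>
        (hcover hx).resolve_right fun h' => hne' ⟨x, hx, h'⟩
  · exact h.neg.false_of_forall_le fun x hx =>
      (hcover hx).resolve_left fun h' => hne ⟨x, hx, h'⟩

end SeventeenQuarters

/-! ### One receiver: no ratio below 3 + 2√2 -/

/-- Far from the origin, all points are visited late: `x` not before time `(ν - 1) * |x|`. -/
def SlowFrom {ι : Type*} (q : ι → ℝ → ℝ) (ν X : ℝ) : Prop :=
  ∀ i t, 0 ≤ t → X < |q i t| → (ν - 1) * |q i t| ≤ t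

theorem SlowFrom.neg {ι : Type*} {q : ι → ℝ → ℝ} {ν X : ℝ} (h : SlowFrom q ν X) :
    SlowFrom (fun i t => -q i t) ν X := by
  simpa [SlowFrom] using h

namespace IsSearchPlan

variable {ι : Type*} {C : ℝ} {q : ι → ℝ → ℝ} {s : ι}

/-- To be notified in time of a target on the left, the sender cannot go far to the right early. -/
theorem add_lt_of_sub_lt (h : IsSearchPlan C q s) {y D t : ℝ} (hy : 1 < y)
    (hD : ∀ i t, 0 ≤ t → q i t = -y → D ≤ t) (ht : t - q s t < D + y) :
    t + q s t < (C - 1) * y := by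
  have ay : |-y| = y := by rw [abs_neg]; exact abs_of_pos (by linarith)
  obtain ⟨t₂, -, k1, k2, -⟩ := h.notify (-y) D (by rwa [ay]) hD
  rw [ay] at k2
  have a2 := neg_le_abs (-y - q s t₂)
  -- Both `t - q s t` and `t + q s t` are nondecreasing in t.
  rcases le_total t t₂ with h' | h'
  · linarith [(h.sub_le s h').2]
  · linarith [(h.sub_le s h').1]

theorem lt_of_slowFrom (h : IsSearchPlan C q s) {ν X : ℝ} (hX : 1 ≤ X) (hs : SlowFrom q ν X) :
    ν < C - 1 := by
  by_contra! hν
  set x := X + 1 with hx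
  have ax : |x| = x := abs_of_pos (by linarith)
  obtain ⟨t₁, -, h1, h2, -⟩ := h.notify x ((ν - 1) * x) (by rw [ax]; linarith)
    fun i t ht hi => by
      have := hs i t ht (by rw [hi, ax]; linarith)
      rwa [hi, ax] at this
  rw [ax] at h2
  have a1 := le_abs_self (x - q s t₁)
  have hm : (C - 1) * x ≤ ν * x := mul_le_mul_of_nonneg_right hν (by linarith)
  have := h.add_lt_of_sub_lt (y := x) (D := (ν - 1) * x) (t := t₁) (by linarith)
    (fun i t ht hi => by
      have := hs i t ht (by rw [hi, abs_neg, ax]; linarith)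
      rwa [hi, abs_neg, ax] at this) (by linarith)
  linarith

/-- If all far points are visited late, then the sender visits them even later. -/
theorem sender_late (h : IsSearchPlan C q s) {ν X t x : ℝ} (hX : 1 ≤ X) (hs : SlowFrom q ν X)
    (hν : 2 ≤ ν) (hx : (C - 1) * X < 2 * x) (ht : 0 ≤ t) (hq : q s t = x) :
    (C - 1 + ν) * x ≤ (C - 1 - ν) * t := by
  have hνA := h.lt_of_slowFrom hX hs
  have hA : 0 < C - 1 := by linarith
  by_contra! hlt
  have hxt := (h.le_time s ht).1
  -- For this y the conclusion of `add_lt_of_sub_lt` just fails, so ν y ≤ t - x.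
  set y := (t + x) / (C - 1) with hy
  have hyA : (C - 1) * y = t + x := by rw [hy]; field_simp
  have hyX : X < y := by
    rw [hy, lt_div_iff₀ hA]
    linarith
  have ay : |-y| = y := by rw [abs_neg]; exact abs_of_pos (by linarith)
  have := h.add_lt_of_sub_lt (y := y) (D := (ν - 1) * y) (t := t) (by linarith)
    (fun i t ht hi => by
      have := hs i t ht (by rw [hi, ay]; linarith)
      rwa [hi, ay] at this)
    (by
      refine lt_of_mul_lt_mul_left ?_ hA.le
      have e : (C - 1) * ((ν - 1) * y + y) = ν * (t + x) := by rw [← hyA]; ring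
      rw [e, hq]
      linarith)
  linarith

theorem exists_first_visit [Finite ι] (h : IsSearchPlan C q s) {x : ℝ} (hx : 1 < |x|) :
    ∃ t j, 0 ≤ t ∧ q j t = x ∧ ∀ i t', 0 ≤ t' → q i t' = x → t ≤ t' := by
  set J : Set ℝ := Set.Ici 0 ∩ ⋃ k, q k ⁻¹' {x} with hJ
  have hJc : IsClosed J := isClosed_Ici.inter <|
    isClosed_iUnion_of_finite fun k => isClosed_singleton.preimage (h.continuous k)
  have hbdd : BddBelow J := ⟨0, fun t ht => ht.1⟩
  have hne : J.Nonempty := by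
    by_contra hne
    -- If x is never visited, any D is vacuously a lower bound.
    obtain ⟨t₁, -, h1, h2, -⟩ := h.notify x (C * |x|) hx fun i t ht hi =>
      (hne ⟨t, ht, Set.mem_iUnion.2 ⟨i, hi⟩⟩).elim
    linarith [abs_nonneg (x - q s t₁)]
  obtain ⟨h0, hm⟩ := hJc.csInf_mem hne hbdd
  obtain ⟨j, hj⟩ := Set.mem_iUnion.1 hm
  exact ⟨sInf J, j, h0, hj, fun i t' ht' hi => csInf_le hbdd ⟨ht', Set.mem_iUnion.2 ⟨i, hi⟩⟩⟩

end IsSearchPlan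

/-- The least gain in each improvement of the delay. -/
noncomputable def delayGain (A : ℝ) : ℝ := (4 * A + 4 - A ^ 2) / (2 * (A + 1))

section Gain

variable {A ν : ℝ}

theorem delayGain_pos (hA : 0 < A) (hA2 : A ^ 2 < 4 * A + 4) : 0 < delayGain A :=
  div_pos (by linarith) (by linarith)

theorem delayGain_le (hA : 1 ≤ A) : delayGain A ≤ 2 - A / 4 := by
  rw [delayGain, div_le_iff₀ (by linarith)]
  nlinarith

theorem add_delayGain_le_of_receiver (hA : 1 ≤ A) : ν + delayGain A ≤ 2 + ν ^ 2 / A := by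
  have h1 := delayGain_le hA
  have h2 : ν - A / 4 ≤ ν ^ 2 / A := by
    rw [le_div_iff₀ (by linarith)]
    nlinarith [sq_nonneg (ν - A / 2)]
  linarith

theorem add_delayGain_le_of_sender (hA2 : A ^ 2 < 4 * A + 4) (hν : 2 ≤ ν) (hνA : ν < A) :
    ν + delayGain A ≤ 2 + (2 * ((A + ν) / (A - ν)) - A) * (ν / A) := by
  have hA : 0 < A := by linarith
  have hd : 0 < A - ν := by linarith
  have hg := delayGain_pos hA hA2
  set κ := A ^ 2 - A ^ 2 * ν + (A + 1) * ν ^ 2 with hκ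
  have h1 : A ^ 2 * delayGain A ≤ 2 * κ := by
    rw [delayGain, mul_div_assoc', div_le_iff₀ (by linarith)]
    -- As a quadratic in ν, κ has minimum A²/2 times `delayGain A`; this explains the form of the
    -- gain.
    nlinarith [sq_nonneg (2 * (A + 1) * ν - A ^ 2)]
  have h2 : 2 + (2 * ((A + ν) / (A - ν)) - A) * (ν / A) - ν = 2 * κ / (A * (A - ν)) := by
    rw [hκ]
    field_simp
    ring
  have h3 : delayGain A ≤ 2 * κ / (A * (A - ν)) := by
    rw [le_div_iff₀ (by positivity)]
    refine le_trans ?_ h1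
    have : A * (A - ν) ≤ A ^ 2 := by nlinarith
    nlinarith
  linarith

theorem mul_add_delayGain_le (hA2 : A ^ 2 < 4 * A + 4) (hν : 2 ≤ ν) (hνA : ν < A) :
    (A - ν) * (ν + delayGain A) ≤ 2 * A := by
  have h1 := delayGain_le (A := A) (by linarith)
  have h2 : (A - ν) * (ν + delayGain A) ≤ (A - ν) * (ν + (2 - A / 4)) :=
    mul_le_mul_of_nonneg_left (by linarith) (by linarith)
  have hA8 : A < 8 := by nlinarith
  nlinarith [sq_nonneg (ν - A / 2), mul_pos (show 0 < ν by linarith) (sub_pos.2 hA8)]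

end Gain

section TwoAgents

variable {ι : Type*} {C : ℝ} {q : ι → ℝ → ℝ} {s r : ι}

theorem IsSearchPlan.left_delay_improves (h : IsSearchPlan C q s) (hr : ∀ i, i = s ∨ i = r)
    (hC : (C - 1) ^ 2 < 4 * (C - 1) + 4) {ν X : ℝ} (hX : 1 ≤ X) (hν : 2 ≤ ν)
    (hs : SlowFrom q ν X) {i : ι} {τ y : ℝ} (hτ : 0 ≤ τ) (hq : q i τ = -y)
    (hy : (C - 1) ^ 2 * X < y) : (ν + delayGain (C - 1) - 1) * y ≤ τ := by
  have hνA := h.lt_of_slowFrom hX hs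
  have : Finite ι := Finite.of_surjective (fun b : Bool => bif b then s else r) fun i => by
    rcases hr i with rfl | rfl
    exacts [⟨true, rfl⟩, ⟨false, rfl⟩]
  set A := C - 1 with hAdef
  have hCA : C = A + 1 := by rw [hAdef]; ring
  have hA : 2 < A := by linarith
  have hAX : X < A * X := by nlinarith
  have hAAX : A * X * 2 < y := by nlinarith
  have hτy : (ν - 1) * y ≤ τ := by
    have ay : |-y| = y := by rw [abs_neg]; exact abs_of_pos (by linarith)
    have := hs i τ hτ (by rw [hq, ay]; linarith)
    rwa [hq, ay] at this
  suffices hgoal : (ν + delayGain A) * y ≤ τ + y by linarith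
  rcases hr i with rfl | rfl
  · have hl := h.neg.sender_late (x := y) hX hs.neg hν (by rw [← hAdef]; linarith) hτ (by simp [hq])
    rw [← hAdef] at hl
    have h1 := mul_le_mul_of_nonneg_right (mul_add_delayGain_le hC hν hνA)
      (show 0 ≤ y by linarith)
    refine le_of_mul_le_mul_left ?_ (show 0 < A - ν by linarith)
    linarith
  -- The balance A x = ν y: a receiver at -y at time τ ≥ (ν - 1) y cannot be back at x before time
  -- (A + 1) x, so x must be found by time τ.
  set x := ν / A * y with hxdef
  have hxA : A * x = ν * y := by rw [hxdef]; field_simp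
  have hx : A * X < 2 * x := by
    refine lt_of_mul_lt_mul_left ?_ (show 0 ≤ A by linarith)
    nlinarith
  have hx' : X < x := by
    refine lt_of_mul_lt_mul_left ?_ (show 0 ≤ A by linarith)
    nlinarith
  have ax : |x| = x := abs_of_pos (by linarith)
  obtain ⟨t, j, ht0, hj, ht⟩ := h.exists_first_visit (x := x) (by rw [ax]; linarith)
  have hnf := h.lt_of_not_found (by rw [ax]; linarith) ht0 ht
  rw [ax, hCA] at hnf
  rcases hr j with rfl | rfl
  -- The sender is late at x, and at that time t the receiver must be right of t - A x, hence still
  -- far from -y.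
  · have hl := h.sender_late hX hs hν hx ht0 hj
    rw [← hAdef] at hl
    have hrt := (le_abs_self _).trans_lt (show |x - q i t| < (A + 1) * x - t by linarith [hnf i])
    rcases le_total t τ with htτ | htτ
    · have h1 := (h.sub_le i htτ).2
      rw [hq] at h1
      have h2 : (A + ν) / (A - ν) * x ≤ t := by
        rw [div_mul_eq_mul_div, div_le_iff₀ (by linarith)]
        linarith
      have h3 := mul_le_mul_of_nonneg_right (add_delayGain_le_of_sender hC hν hνA)
        (show 0 ≤ y by linarith)
      have h4 : (2 + (2 * ((A + ν) / (A - ν)) - A) * (ν / A)) * y =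
          2 * y + 2 * ((A + ν) / (A - ν) * x) - A * x := by rw [hxdef]; ring
      linarith
    · have h1 := (h.sub_le i htτ).1
      rw [hq] at h1
      linarith
  · rcases le_total t τ with htτ | htτ
    · have h1 := (h.sub_le j htτ).2
      rw [hq, hj] at h1
      have h2 := hs j t ht0 (by rwa [hj, ax])
      rw [hj, ax] at h2
      have h3 := mul_le_mul_of_nonneg_right (add_delayGain_le_of_receiver (A := A) (ν := ν)
        (by linarith)) (show 0 ≤ y by linarith)
      have h4 : (2 + ν ^ 2 / A) * y = 2 * y + ν * x := by rw [hxdef]; ring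
      linarith
    · have h1 := (h.sub_le j htτ).1
      rw [hq, hj] at h1
      linarith [hnf j, abs_nonneg (x - q j t)]

theorem IsSearchPlan.delay_improves (h : IsSearchPlan C q s) (hr : ∀ i, i = s ∨ i = r)
    (hC : (C - 1) ^ 2 < 4 * (C - 1) + 4) {ν X : ℝ} (hX : 1 ≤ X) (hν : 2 ≤ ν)
    (hs : SlowFrom q ν X) : SlowFrom q (ν + delayGain (C - 1)) ((C - 1) ^ 2 * X) := by
  intro i t ht hq
  rcases le_total 0 (q i t) with h0 | h0
  · rw [abs_of_nonneg h0] at hq ⊢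
    exact h.neg.left_delay_improves hr hC hX hν hs.neg ht rfl hq
  · rw [abs_of_nonpos h0] at hq ⊢
    exact h.left_delay_improves hr hC hX hν hs ht (neg_neg _).symm hq

theorem not_isSearchPlan_of_two_agents (h : IsSearchPlan C q s) (hr : ∀ i, i = s ∨ i = r)
    (hC : (C - 1) ^ 2 < 4 * (C - 1) + 4) : False := by
  have h2 : SlowFrom q 2 1 := fun i t ht _ => by
    have := h.le_time i ht
    linarith [abs_le.2 ⟨by linarith, this.1⟩]
  have hA := h.lt_of_slowFrom le_rfl h2
  have hg := delayGain_pos (by linarith) hC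
  have key : ∀ n : ℕ, ∃ X, 1 ≤ X ∧ SlowFrom q (2 + n * delayGain (C - 1)) X := by
    intro n
    induction n with
    | zero => exact ⟨1, le_rfl, by simpa using h2⟩
    | succ n ih =>
      obtain ⟨X, hX, hs⟩ := ih
      refine ⟨_, ?_, by
        convert h.delay_improves hr hC hX (le_add_of_nonneg_right (by positivity)) hs using 1
        push_cast
        ring⟩
      nlinarith
  obtain ⟨n, hn⟩ := exists_nat_gt ((C - 1) / delayGain (C - 1))
  rw [div_lt_iff₀ hg] at hn
  obtain ⟨X, hX, hs⟩ := key n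
  linarith [h.lt_of_slowFrom hX hs]

end TwoAgents

end LineEvacuation

theorem theorem3p1 (nr : ℕ) (hnr : 1 ≤ nr) (A : LineEvacuation.EvacuationAlgorithm 1 nr) :
    (nr = 1 → ENNReal.ofReal (3 + 2 * Real.sqrt 2) ≤ A.competitiveRatio) ∧
    (1 < nr → ENNReal.ofReal (2 + Real.sqrt 5) ≤ A.competitiveRatio) := by
  constructor
  · rintro rfl
    by_contra! hlt
    obtain ⟨C, hC0, hAC, hC⟩ := ENNReal.lt_iff_exists_real_btwn.1 hlt
    have hC' : C < 3 + 2 * √2 := (ENNReal.ofReal_lt_ofReal_iff (by positivity)).1 hC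
    have h2 : √2 ^ 2 = 2 := Real.sq_sqrt (by norm_num)
    have h1 : 1 < √2 := by
      rw [Real.lt_sqrt] <;> norm_num
    -- C is raised to at least 3 since the quadratic condition fails for small C, such as C = 0.
    refine LineEvacuation.not_isSearchPlan_of_two_agents (r := Sum.inr 0)
      ((A.isSearchPlan hAC).mono (le_max_left C 3)) (fun i => ?_) ?_
    · rcases i with i | i
      · exact Or.inl (by rw [Subsingleton.elim i 0])
      · exact Or.inr (by rw [Subsingleton.elim i 0])
    · have h3 : 3 ≤ max C 3 := le_max_right C 3
      have h4 : max C 3 < 3 + 2 * √2 := max_lt hC' (by linarith)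
      nlinarith
  · intro _
    by_contra! hlt
    have h5 : √5 ≤ 9 / 4 := Real.sqrt_le_iff.2 ⟨by norm_num, by norm_num⟩
    exact LineEvacuation.not_isSearchPlan_seventeen_quarters
      ((A.isSearchPlan hlt).mono (by linarith))
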